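/- Let $F$ be an arbitrary field and let $L$ be a finite-dimensional (left) Leibniz algebra over $F$, that is, a finite-dimensional vector space with a bilinear product satisfying $a(bc)=(ab)c+b(ac)$ for all $a,b,c\in L$. For a subalgebra $S$ of $L$ (possibly $S=L$), let $S^2=SS$ be the subalgebra spanned by all products of two elements of $S$. Call $S$ solvable if its derived series $S^{(0)}=S$, $S^{(n+1)}=S^{(n)}S^{(n)}$ reaches $0$; nilpotent if its lower central series $S^1=S$, $S^{n+1}=S\,S^{n}$ reaches $0$; and strongly solvable if the algebra $S^2$ is nilpotent. Suppose that $L$ is solvable and minimally non-strongly solvable, i.e. $L$ is not strongly solvable but every proper subalgebra of $L$ is strongly solvable. Then $L$ is generated, as an algebra, by two elements. -/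

import Mathlib

/-- A (left) Leibniz ring: left multiplications are derivations. A Leibniz algebra over a field `F`
is an `F`-algebra (not necessarily associative, not necessarily unital) with this property. -/
class IsLeibniz (L : Type*) [NonUnitalNonAssocRing L] : Prop where
  leibniz : ∀ a b c : L, a * (b * c) = (a * b) * c + b * (a * c)

namespace Leibniz

variable {F L : Type*} [Field F] [NonUnitalNonAssocRing L] [Module F L]
  [IsScalarTower F L L] [SMulCommClass F L L]

/-- The linear span of all products `u * v` with `u ∈ U` and `v ∈ V`. -/
def prod (U V : Submodule F L) : Submodule F L :=
  Submodule.map₂ (LinearMap.mul F L) U V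

theorem prod_le_self (S : NonUnitalSubalgebra F L) :
    prod S.toSubmodule S.toSubmodule ≤ S.toSubmodule :=
  Submodule.map₂_le.2 fun _ ha _ hb => S.mul_mem ha hb

/-- The subalgebra `S² = S S` of `S`, spanned by all products of two elements of `S`. -/
def square (S : NonUnitalSubalgebra F L) : NonUnitalSubalgebra F L where
  toAddSubmonoid := (prod S.toSubmodule S.toSubmodule).toAddSubmonoid
  smul_mem' := (prod S.toSubmodule S.toSubmodule).smul_mem'
  mul_mem' := fun ha hb =>
    Submodule.apply_mem_map₂ (LinearMap.mul F L) (prod_le_self S ha) (prod_le_self S hb)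

/-- The derived series `S, S², (S²)², …`. -/
def derivedSeries (S : NonUnitalSubalgebra F L) : ℕ → NonUnitalSubalgebra F L
  | 0 => S
  | n + 1 => square (derivedSeries S n)

/-- The lower central series of `S`: `S, S S, S (S S), …`. -/
def lowerCentralSeries (S : NonUnitalSubalgebra F L) : ℕ → Submodule F L
  | 0 => S.toSubmodule
  | n + 1 => prod S.toSubmodule (lowerCentralSeries S n)

/-- `S`, as an algebra in its own right, is solvable. -/
def IsSolvable (S : NonUnitalSubalgebra F L) : Prop :=
  ∃ n : ℕ, derivedSeries S n = ⊥

/-- `S`, as an algebra in its own right, is nilpotent. -/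
def IsNilpotent (S : NonUnitalSubalgebra F L) : Prop :=
  ∃ n : ℕ, lowerCentralSeries S n = ⊥

/-- `S`, as an algebra in its own right, is strongly solvable: `S²` is nilpotent. -/
def IsStronglySolvable (S : NonUnitalSubalgebra F L) : Prop :=
  IsNilpotent (square S)

variable (F L) in
/-- `L` is not strongly solvable, but each of its proper subalgebras is. -/
def IsMinimallyNonStronglySolvable : Prop :=
  ¬ IsStronglySolvable (⊤ : NonUnitalSubalgebra F L) ∧
    ∀ S : NonUnitalSubalgebra F L, S ≠ ⊤ → IsStronglySolvable S

variable (F L) in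
/-- `L` is generated, as an algebra, by two elements. -/
def IsTwoGenerated : Prop :=
  ∃ x y : L, NonUnitalAlgebra.adjoin F {x, y} = ⊤

end Leibniz

namespace Leibniz

variable {F L : Type*} [Field F] [NonUnitalNonAssocRing L] [Module F L]
  [IsScalarTower F L L] [SMulCommClass F L L]

/-! Choose an ideal B maximal among those modulo which L² is not nilpotent, and a minimal ideal A
above B. Then L² is nilpotent modulo A, and A/B is abelian and irreducible under left
multiplication. An Engel-type argument gives a product m = xy acting non-nilpotently on A/B, and the
Fitting null component of m on A/B is then zero. By minimality, a subalgebra containing x and y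
modulo A is either L or meets A inside B. Counting dimensions gives (a, b) in A × A, not both in B,
with xb + ay in B, so (x+a)(y+b) ≡ m modulo B. If neither {x, y} nor {x+a, y+b} generates L, some
power of m sends both generated subalgebras into B, hence also a and b. Both then lie in B, a
contradiction. -/

/-- A two-sided ideal of `L`, as a submodule. -/
structure IsIdeal (I : Submodule F L) : Prop where
  mul_left : ∀ s : L, ∀ a ∈ I, s * a ∈ I
  mul_right : ∀ a ∈ I, ∀ s : L, a * s ∈ I

/-- `A / B` is a chief factor of `L`: `A` is minimal among the ideals strictly above `B`. -/
structure IsChiefFactor (B A : Submodule F L) : Prop where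
  ideal_bot : IsIdeal B
  ideal_top : IsIdeal A
  lt : B < A
  eq_top : ∀ C : Submodule F L, IsIdeal C → B < C → C ≤ A → C = A

theorem mul_mem_prod {U V : Submodule F L} {u v : L} (hu : u ∈ U) (hv : v ∈ V) :
    u * v ∈ prod U V :=
  Submodule.apply_mem_map₂ (LinearMap.mul F L) hu hv

theorem prod_le {U V W : Submodule F L} : prod U V ≤ W ↔ ∀ u ∈ U, ∀ v ∈ V, u * v ∈ W :=
  Submodule.map₂_le

theorem mul_mem_prod_sup {U V B : Submodule F L} (hB : IsIdeal B) {u v : L} (hu : u ∈ U ⊔ B)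
    (hv : v ∈ V ⊔ B) : u * v ∈ prod U V ⊔ B := by
  obtain ⟨s, hs, a, ha, rfl⟩ := Submodule.mem_sup.1 hu
  obtain ⟨t, ht, b, hb, rfl⟩ := Submodule.mem_sup.1 hv
  refine Submodule.mem_sup.2 ⟨s * t, mul_mem_prod hs ht, s * b + a * (t + b), ?_, ?_⟩
  · exact B.add_mem (hB.mul_left _ _ hb) (hB.mul_right _ ha _)
  · rw [add_mul s a (t + b), mul_add s t b]; abel

omit [IsScalarTower F L L] in
theorem mulLeft_pow_succ_apply (m z : L) (j : ℕ) :
    (LinearMap.mulLeft F m ^ (j + 1)) z = (LinearMap.mulLeft F m ^ j) (m * z) := by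
  rw [pow_succ, Module.End.mul_apply, LinearMap.mulLeft_apply]

omit [IsScalarTower F L L] in
theorem mulLeft_pow_succ_apply' (m z : L) (j : ℕ) :
    (LinearMap.mulLeft F m ^ (j + 1)) z = m * (LinearMap.mulLeft F m ^ j) z := by
  rw [pow_succ', Module.End.mul_apply, LinearMap.mulLeft_apply]

omit [IsScalarTower F L L] in
theorem mulLeft_pow_mem {C : Submodule F L} {m : L} (hC : ∀ c ∈ C, m * c ∈ C) (j : ℕ) {c : L}
    (hc : c ∈ C) : (LinearMap.mulLeft F m ^ j) c ∈ C := by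
  induction j with
  | zero => simpa using hc
  | succ j ih => rw [mulLeft_pow_succ_apply']; exact hC _ ih

omit [IsScalarTower F L L] in
/-- Congruent elements modulo an ideal have congruent iterated left multiplications. -/
theorem mulLeft_pow_sub_mem {B : Submodule F L} (hB : IsIdeal B) {m n : L} (h : m - n ∈ B)
    (j : ℕ) (z : L) : (LinearMap.mulLeft F m ^ j) z - (LinearMap.mulLeft F n ^ j) z ∈ B := by
  induction j with
  | zero => simp
  | succ j ih =>
    rw [mulLeft_pow_succ_apply', mulLeft_pow_succ_apply']
    set u := (LinearMap.mulLeft F m ^ j) z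
    set v := (LinearMap.mulLeft F n ^ j) z
    have : m * u - n * v = (m - n) * u + n * (u - v) := by rw [sub_mul, mul_sub]; abel
    rw [this]
    exact B.add_mem (hB.mul_right _ h _) (hB.mul_left _ _ ih)

theorem mul_mem_square {S : NonUnitalSubalgebra F L} {x y : L} (hx : x ∈ S) (hy : y ∈ S) :
    x * y ∈ square S :=
  mul_mem_prod (F := F) hx hy

/-- The subalgebra `S + I` for an ideal `I`. -/
def addIdeal (S : NonUnitalSubalgebra F L) (I : Submodule F L) (hI : IsIdeal I) :
    NonUnitalSubalgebra F L where
  toAddSubmonoid := (S.toSubmodule ⊔ I).toAddSubmonoid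
  smul_mem' := (S.toSubmodule ⊔ I).smul_mem'
  mul_mem' := by
    intro u v hu hv
    exact sup_le_sup_right (prod_le_self S) I (mul_mem_prod_sup hI hu hv)

theorem mem_addIdeal {S : NonUnitalSubalgebra F L} {I : Submodule F L} {hI : IsIdeal I} {z : L} :
    z ∈ addIdeal S I hI ↔ z ∈ S.toSubmodule ⊔ I := Iff.rfl

theorem mulLeft_pow_mem_lowerCentralSeries {S : NonUnitalSubalgebra F L} {m z : L} (hm : m ∈ S)
    (hz : z ∈ S) (j : ℕ) : (LinearMap.mulLeft F m ^ j) z ∈ lowerCentralSeries S j := by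
  induction j with
  | zero => exact hz
  | succ j ih => rw [mulLeft_pow_succ_apply']; exact mul_mem_prod hm ih

/-- Modulo an ideal `B` with `S + B = L`, the lower central series of `S²` and `L²` agree. -/
theorem lowerCentralSeries_square_top_le {S : NonUnitalSubalgebra F L} {B : Submodule F L}
    (hB : IsIdeal B) (hS : S.toSubmodule ⊔ B = ⊤) (n : ℕ) :
    lowerCentralSeries (square (⊤ : NonUnitalSubalgebra F L)) n ≤
      lowerCentralSeries (square S) n ⊔ B := by
  have key : ∀ U V U' V' : Submodule F L, U' ≤ U ⊔ B → V' ≤ V ⊔ B → prod U' V' ≤ prod U V ⊔ B := by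
    intro U V U' V' hU hV
    exact prod_le.2 fun u hu v hv => mul_mem_prod_sup hB (hU hu) (hV hv)
  have h0 : (square (⊤ : NonUnitalSubalgebra F L)).toSubmodule ≤ (square S).toSubmodule ⊔ B :=
    key _ _ _ _ (by rw [hS]; exact le_top) (by rw [hS]; exact le_top)
  induction n with
  | zero => exact h0
  | succ n ih => exact key _ _ _ _ h0 ih

/-- Each term of the lower central series of `L²` is spanned by products. -/
theorem lowerCentralSeries_square_top_le_of_mul (n : ℕ) {W : Submodule F L}
    (h : ∀ x y : L, x * y ∈ lowerCentralSeries (square (⊤ : NonUnitalSubalgebra F L)) n →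
      x * y ∈ W) : lowerCentralSeries (square (⊤ : NonUnitalSubalgebra F L)) n ≤ W := by
  cases n with
  | zero => exact prod_le.2 fun u hu v hv => h u v (mul_mem_prod hu hv)
  | succ n => exact prod_le.2 fun u hu v hv => h u v (mul_mem_prod hu hv)

theorem lowerCentralSeries_le_toSubmodule (S : NonUnitalSubalgebra F L) (n : ℕ) :
    lowerCentralSeries S n ≤ S.toSubmodule := by
  induction n with
  | zero => exact le_rfl
  | succ n ih => exact prod_le.2 fun u hu v hv => S.mul_mem hu (ih hv)

-- The map (a, b) ↦ xb + ay from (A/B)² to A/B cannot be injective.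
omit [IsScalarTower F L L] in
theorem IsChiefFactor.exists_mul_add_mul_mem [FiniteDimensional F L] {A B : Submodule F L}
    (h : IsChiefFactor B A) (x y : L) :
    ∃ a ∈ A, ∃ b ∈ A, x * b + a * y ∈ B ∧ ¬ (a ∈ B ∧ b ∈ B) := by
  by_cases hx : ∃ b ∈ A, x * b ∈ B ∧ b ∉ B
  · obtain ⟨b, hb, hxb, hbB⟩ := hx
    exact ⟨0, A.zero_mem, b, hb, by simpa using hxb, fun h' => hbB h'.2⟩
  push Not at hx
  let f : (A ⧸ B.submoduleOf A) →ₗ[F] (A ⧸ B.submoduleOf A) :=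
    (B.submoduleOf A).mapQ (B.submoduleOf A)
      ((LinearMap.mulLeft F x).restrict (h.ideal_top.mul_left x))
      (fun b hb => h.ideal_bot.mul_left x b hb)
  have hf : Function.Injective f := by
    rw [← LinearMap.ker_eq_bot, LinearMap.ker_eq_bot']
    intro q hq
    obtain ⟨b, rfl⟩ := Submodule.Quotient.mk_surjective _ q
    have : x * b.1 ∈ B := (Submodule.Quotient.mk_eq_zero (B.submoduleOf A)).1 hq
    exact (Submodule.Quotient.mk_eq_zero _).2 (hx b b.2 this)
  obtain ⟨a, ha, haB⟩ := SetLike.exists_of_lt h.lt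
  obtain ⟨q, hq⟩ := LinearMap.injective_iff_surjective.1 hf
    (Submodule.Quotient.mk ⟨-(a * y), A.neg_mem (h.ideal_top.mul_right a ha y)⟩)
  obtain ⟨b, rfl⟩ := Submodule.Quotient.mk_surjective _ q
  have : x * b.1 - -(a * y) ∈ B := (Submodule.Quotient.eq (B.submoduleOf A)).1 hq
  exact ⟨a, ha, b, b.2, by simpa using this, fun h' => haB h'.1⟩

theorem exists_isChiefFactor [FiniteDimensional F L]
    (hL : ¬ IsStronglySolvable (⊤ : NonUnitalSubalgebra F L)) :
    ∃ B A : Submodule F L, IsChiefFactor B A ∧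
      (∀ n, ¬ lowerCentralSeries (square (⊤ : NonUnitalSubalgebra F L)) n ≤ B) ∧
      ∃ n, lowerCentralSeries (square (⊤ : NonUnitalSubalgebra F L)) n ≤ A := by
  obtain ⟨B, ⟨hBi, hB⟩, hBmax⟩ := WellFounded.has_min (wellFounded_gt (α := Submodule F L))
    {B | IsIdeal B ∧ ∀ n, ¬ lowerCentralSeries (square (⊤ : NonUnitalSubalgebra F L)) n ≤ B}
    ⟨⊥, ⟨fun s a ha => by simp_all, fun a ha s => by simp_all⟩,
      fun n hn => hL ⟨n, le_bot_iff.1 hn⟩⟩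
  obtain ⟨A, ⟨hAi, hA⟩, hAmin⟩ := WellFounded.has_min (wellFounded_lt (α := Submodule F L))
    {A | IsIdeal A ∧ B < A}
    ⟨⊤, ⟨fun s a _ => Submodule.mem_top, fun a _ s => Submodule.mem_top⟩,
      lt_top_iff_ne_top.2 fun e => hB 0 (e ▸ le_top)⟩
  refine ⟨B, A, ⟨hBi, hAi, hA, fun C hC hBC hCA => ?_⟩, hB, ?_⟩
  · by_contra hne
    exact hAmin C ⟨hC, hBC⟩ (lt_of_le_of_ne hCA hne)
  · by_contra! hcon
    exact hBmax A ⟨hAi, hcon⟩ hA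

/-! ### Left module structure of a chief factor -/

variable [IsLeibniz L]

theorem lowerCentralSeries_square_top_mul_left (n : ℕ) (s : L) {z : L}
    (hz : z ∈ lowerCentralSeries (square (⊤ : NonUnitalSubalgebra F L)) n) :
    s * z ∈ lowerCentralSeries (square (⊤ : NonUnitalSubalgebra F L)) n := by
  have h0 : ∀ s z : L, z ∈ square (⊤ : NonUnitalSubalgebra F L) →
      s * z ∈ square (⊤ : NonUnitalSubalgebra F L) := fun s z _ =>
    mul_mem_square NonUnitalAlgebra.mem_top NonUnitalAlgebra.mem_top
  induction n generalizing s z with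
  | zero => exact h0 s z hz
  | succ n ih =>
    refine (prod_le (W := (lowerCentralSeries (square (⊤ : NonUnitalSubalgebra F L)) (n + 1)).comap
      (LinearMap.mulLeft F s))).2 (fun u hu v hv => ?_) hz
    rw [Submodule.mem_comap, LinearMap.mulLeft_apply, IsLeibniz.leibniz]
    exact Submodule.add_mem _ (mul_mem_prod (h0 s u hu) hv) (mul_mem_prod hu (ih s hv))

namespace IsChiefFactor

variable {A B : Submodule F L}

/-- A chief factor is irreducible as a left module. -/
theorem eq_or_eq_of_mul_left (h : IsChiefFactor B A) {C : Submodule F L} (hBC : B ≤ C)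
    (hCA : C ≤ A) (hC : ∀ s : L, ∀ c ∈ C, s * c ∈ C) : C = B ∨ C = A := by
  suffices hr : ∀ c ∈ C, ∀ s : L, c * s ∈ C by
    rcases hBC.eq_or_lt with e | e
    · exact Or.inl e.symm
    · exact Or.inr (h.eq_top C ⟨hC, hr⟩ e hCA)
  -- Modulo B, E measures the failure of right multiplication to be minus left multiplication. It is
  -- an ideal killing L from the left modulo B, so either E = B and the two actions differ by sign,
  -- or E = A and the right action is zero.
  let E : Submodule F L := Submodule.span F {z | ∃ s : L, ∃ a ∈ A, z = s * a + a * s} ⊔ B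
  have hEA : E ≤ A := by
    refine sup_le (Submodule.span_le.2 ?_) h.lt.le
    rintro _ ⟨s, a, ha, rfl⟩
    exact A.add_mem (h.ideal_top.mul_left _ _ ha) (h.ideal_top.mul_right _ ha _)
  have hgen : ∀ s : L, ∀ a ∈ A, s * a + a * s ∈ E := fun s a ha =>
    Submodule.mem_sup_left (Submodule.subset_span ⟨s, a, ha, rfl⟩)
  have hzero : ∀ e ∈ E, ∀ t : L, e * t ∈ B := by
    intro e he t
    have : E ≤ B.comap (LinearMap.mulRight F t) := by
      refine sup_le (Submodule.span_le.2 ?_) fun b hb => h.ideal_bot.mul_right b hb t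
      rintro _ ⟨s, a, ha, rfl⟩
      have : (s * a + a * s) * t = 0 := by
        have h1 := IsLeibniz.leibniz s a t
        have h2 := IsLeibniz.leibniz a s t
        rw [add_mul, eq_sub_of_add_eq h1.symm, eq_sub_of_add_eq h2.symm]
        abel
      simp [this]
    exact this he
  have hE : IsIdeal E := by
    refine ⟨fun t e he => ?_, fun e he t => Submodule.mem_sup_right (hzero e he t)⟩
    have : E ≤ E.comap (LinearMap.mulLeft F t) := by
      refine sup_le (Submodule.span_le.2 ?_) fun b hb =>
        Submodule.mem_sup_right (h.ideal_bot.mul_left t b hb)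
      rintro _ ⟨s, a, ha, rfl⟩
      have : t * (s * a + a * s) = ((t * s) * a + a * (t * s)) + (s * (t * a) + (t * a) * s) := by
        rw [mul_add, IsLeibniz.leibniz t s a, IsLeibniz.leibniz t a s]; abel
      rw [SetLike.mem_coe, Submodule.mem_comap, LinearMap.mulLeft_apply, this]
      exact E.add_mem (hgen _ _ ha) (hgen _ _ (h.ideal_top.mul_left _ _ ha))
    exact this he
  intro c hc s
  rcases (le_sup_right : B ≤ E).eq_or_lt with e | e
  · have h1 : s * c + c * s ∈ C := hBC (e ▸ hgen s c (hCA hc))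
    simpa using C.sub_mem h1 (hC s c hc)
  · have : E = A := h.eq_top E hE e hEA
    exact hBC (hzero c (this ▸ hCA hc) s)

theorem mul_mem_of_isSolvable (h : IsChiefFactor B A)
    (hsolv : IsSolvable (⊤ : NonUnitalSubalgebra F L)) {a b : L} (ha : a ∈ A) (hb : b ∈ A) :
    a * b ∈ B := by
  have hl : ∀ s : L, ∀ c ∈ prod A A ⊔ B, s * c ∈ prod A A ⊔ B := by
    intro s c hc
    have : prod A A ⊔ B ≤ (prod A A ⊔ B).comap (LinearMap.mulLeft F s) := by
      refine sup_le (prod_le.2 fun u hu v hv => ?_) fun b hb =>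
        Submodule.mem_sup_right (h.ideal_bot.mul_left s b hb)
      rw [Submodule.mem_comap, LinearMap.mulLeft_apply, IsLeibniz.leibniz]
      exact Submodule.mem_sup_left (Submodule.add_mem _
        (mul_mem_prod (h.ideal_top.mul_left _ _ hu) hv)
        (mul_mem_prod hu (h.ideal_top.mul_left _ _ hv)))
    exact this hc
  have hle : prod A A ⊔ B ≤ A :=
    sup_le (prod_le.2 fun u _ v hv => h.ideal_top.mul_left u v hv) h.lt.le
  rcases h.eq_or_eq_of_mul_left le_sup_right hle hl with e | e
  · exact e ▸ Submodule.mem_sup_left (mul_mem_prod ha hb)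
  · exfalso
    obtain ⟨n, hn⟩ := hsolv
    -- If A = AA + B, then A survives modulo B in every derived term.
    have key : ∀ n, A ≤ (derivedSeries (⊤ : NonUnitalSubalgebra F L) n).toSubmodule ⊔ B := by
      intro n
      induction n with
      | zero => exact fun a _ => Submodule.mem_sup_left (NonUnitalAlgebra.mem_top (R := F))
      | succ n ih =>
        rw [← e]
        exact sup_le (prod_le.2 fun u hu v hv => mul_mem_prod_sup h.ideal_bot (ih hu) (ih hv))
          le_sup_right
    refine h.lt.not_ge fun a ha => ?_
    obtain ⟨s, hs, b, hb, rfl⟩ := Submodule.mem_sup.1 (key n ha)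
    rw [hn] at hs
    have : s = 0 := NonUnitalAlgebra.mem_bot.1 hs
    simpa [this] using hb

/-- Left multiplication by an element acting nilpotently on `L / A` has no kernel on an abelian
chief factor `A / B` as soon as it is not nilpotent there. -/
theorem mem_of_mulLeft_pow_mem (h : IsChiefFactor B A) (hab : ∀ a ∈ A, ∀ b ∈ A, a * b ∈ B)
    {m a₀ : L} {p : ℕ} (hm : ∀ s : L, (LinearMap.mulLeft F m ^ p) s ∈ A) (ha₀ : a₀ ∈ A)
    (hn : ∀ j, (LinearMap.mulLeft F m ^ j) a₀ ∉ B) {a : L} (ha : a ∈ A) {j : ℕ}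
    (haj : (LinearMap.mulLeft F m ^ j) a ∈ B) : a ∈ B := by
  have hstable : ∀ i j : ℕ, i ≤ j → ∀ a, (LinearMap.mulLeft F m ^ i) a ∈ B →
      (LinearMap.mulLeft F m ^ j) a ∈ B := by
    intro i j hij a hai
    obtain ⟨k, rfl⟩ := Nat.exists_eq_add_of_le' hij
    rw [pow_add, Module.End.mul_apply]
    exact mulLeft_pow_mem (fun c hc => h.ideal_bot.mul_left m c hc) k hai
  -- Leibniz rule for powers of m: each term of m^(p+q)(sa) has at least p factors on s, landing in
  -- AA ≤ B, or at least q on a.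
  have hprod : ∀ p q : ℕ, ∀ s : L, ∀ a ∈ A, (LinearMap.mulLeft F m ^ p) s ∈ A →
      (LinearMap.mulLeft F m ^ q) a ∈ B → (LinearMap.mulLeft F m ^ (p + q)) (s * a) ∈ B := by
    intro p
    induction p with
    | zero =>
      intro q s a ha hs _
      exact mulLeft_pow_mem (fun c hc => h.ideal_bot.mul_left m c hc) _
        (hab _ (by simpa using hs) _ ha)
    | succ p ihp =>
      intro q
      induction q with
      | zero =>
        intro s a ha _ haq
        exact mulLeft_pow_mem (fun c hc => h.ideal_bot.mul_left m c hc) _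
          (h.ideal_bot.mul_left _ _ (by simpa using haq))
      | succ q ihq =>
        intro s a ha hs haq
        rw [← add_assoc, mulLeft_pow_succ_apply, IsLeibniz.leibniz, map_add]
        refine B.add_mem ?_ ?_
        · rw [mulLeft_pow_succ_apply] at hs
          have := ihp (q + 1) (m * s) a ha hs haq
          rwa [show p + (q + 1) = p + 1 + q by ring] at this
        · rw [mulLeft_pow_succ_apply] at haq
          exact ihq s (m * a) (h.ideal_top.mul_left _ _ ha) hs haq
  -- The Fitting null component of m on A/B.
  let W : Submodule F L :=
    { carrier := {a | a ∈ A ∧ ∃ j, (LinearMap.mulLeft F m ^ j) a ∈ B}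
      zero_mem' := ⟨A.zero_mem, 0, by simp⟩
      add_mem' := by
        rintro a b ⟨ha, i, hai⟩ ⟨hb, j, hbj⟩
        refine ⟨A.add_mem ha hb, max i j, ?_⟩
        rw [map_add]
        exact B.add_mem (hstable _ _ (le_max_left _ _) _ hai) (hstable _ _ (le_max_right _ _) _ hbj)
      smul_mem' := by
        rintro c a ⟨ha, i, hai⟩
        refine ⟨A.smul_mem c ha, i, ?_⟩
        rw [map_smul]
        exact B.smul_mem c hai }
  have hW : W = B ∨ W = A := by
    refine h.eq_or_eq_of_mul_left (fun b hb => ⟨h.lt.le hb, 0, by simpa using hb⟩)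
      (fun a ha => ha.1) ?_
    rintro s c ⟨hc, q, hcq⟩
    exact ⟨h.ideal_top.mul_left _ _ hc, p + q, hprod p q s c hc (hm s) hcq⟩
  have haW : a ∈ W := ⟨ha, j, haj⟩
  rcases hW with e | e
  · exact e ▸ haW
  · obtain ⟨-, i, hi⟩ : a₀ ∈ W := e ▸ ha₀
    exact absurd hi (hn i)

/-- If `L²` is nilpotent modulo `A` but not modulo `B`, then some product of two elements acts
non-nilpotently on `A / B`. -/
theorem exists_mul_not_nilpotent [FiniteDimensional F L] (h : IsChiefFactor B A)
    (hab : ∀ a ∈ A, ∀ b ∈ A, a * b ∈ B) {n : ℕ}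
    (hA : lowerCentralSeries (square (⊤ : NonUnitalSubalgebra F L)) n ≤ A)
    (hB : ∀ n, ¬ lowerCentralSeries (square (⊤ : NonUnitalSubalgebra F L)) n ≤ B) :
    ∃ x y : L, ∃ a ∈ A, ∀ j, (LinearMap.mulLeft F (x * y) ^ j) a ∉ B := by
  classical
  set N := lowerCentralSeries (square (⊤ : NonUnitalSubalgebra F L)) with hN
  have hex : ∃ k, ∀ u ∈ N k, ∀ a ∈ A, u * a ∈ B := ⟨n, fun u hu a ha => hab u (hA hu) a ha⟩
  obtain ⟨k, hk, hmin⟩ : ∃ k, (∀ u ∈ N k, ∀ a ∈ A, u * a ∈ B) ∧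
      ∀ i < k, ¬ ∀ u ∈ N i, ∀ a ∈ A, u * a ∈ B :=
    ⟨Nat.find hex, Nat.find_spec hex, fun i hi => Nat.find_min hex hi⟩
  cases k with
  | zero => exact absurd (prod_le.2 fun u hu v hv => hk u hu v (hA hv)) (hB (n + 1))
  | succ k =>
    by_contra! hcon
    -- By the Leibniz identity, `N k` therefore acts on A/B by commuting operators, so kernels are
    -- stable under `N k`.
    have hcomm : ∀ u ∈ N k, ∀ v ∈ N k, ∀ a ∈ A, (u * v) * a ∈ B := fun u hu v hv a ha =>
      hk _ (mul_mem_prod (lowerCentralSeries_le_toSubmodule _ _ hu) hv) a ha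
    let P : Submodule F L → Prop := fun C =>
      B < C ∧ C ≤ A ∧ ∀ u ∈ N k, ∀ c ∈ C, u * c ∈ C
    obtain ⟨C, ⟨hBC, hCA, hC⟩, hCmin⟩ := WellFounded.has_min
      (wellFounded_lt (α := Submodule F L)) {C | P C}
      ⟨A, h.lt, le_rfl, fun u _ a ha => h.ideal_top.mul_left u a ha⟩
    have hprod : ∀ x y : L, x * y ∈ N k → ∀ c ∈ C, (x * y) * c ∈ B := by
      intro x y hxy
      let C' : Submodule F L := C ⊓ B.comap (LinearMap.mulLeft F (x * y))
      have hBC' : B ≤ C' := le_inf hBC.le fun b hb => h.ideal_bot.mul_left _ b hb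
      have hlt : B < C' := by
        refine lt_of_le_of_ne hBC' fun e => ?_
        obtain ⟨c, hc, hcB⟩ := SetLike.exists_of_lt hBC
        obtain ⟨j, hj⟩ := hcon x y c (hCA hc)
        have : ∀ j, (LinearMap.mulLeft F (x * y) ^ j) c ∉ B := by
          intro j
          induction j with
          | zero => simpa using hcB
          | succ j ih =>
            intro hmem
            rw [mulLeft_pow_succ_apply'] at hmem
            exact ih (e ▸ (⟨mulLeft_pow_mem (hC _ hxy) j hc, hmem⟩ :
              (LinearMap.mulLeft F (x * y) ^ j) c ∈ C'))
        exact this j hj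
      have hP : P C' := by
        refine ⟨hlt, inf_le_left.trans hCA, fun u hu c hc => ⟨hC u hu c hc.1, ?_⟩⟩
        change (x * y) * (u * c) ∈ B
        rw [IsLeibniz.leibniz]
        exact B.add_mem (hcomm _ hxy _ hu _ (hCA hc.1)) (h.ideal_bot.mul_left _ _ hc.2)
      have : C' = C := by
        by_contra hne
        exact hCmin C' hP (lt_of_le_of_ne inf_le_left hne)
      intro c hc
      exact (this ▸ hc : c ∈ C').2
    have hNC : ∀ u ∈ N k, ∀ c ∈ C, u * c ∈ B := by
      intro u hu c hc
      exact lowerCentralSeries_square_top_le_of_mul (W := B.comap (LinearMap.mulRight F c)) k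
        (fun x y hxy => hprod x y hxy c hc) hu
    -- The part of A/B killed by `N k`: nonzero since it contains C, so all of A/B, against the
    -- minimality of k + 1.
    let D : Submodule F L :=
      { carrier := {a | a ∈ A ∧ ∀ u ∈ N k, u * a ∈ B}
        zero_mem' := ⟨A.zero_mem, fun u _ => by simp⟩
        add_mem' := fun {a b} ha hb => ⟨A.add_mem ha.1 hb.1, fun u hu => by
          rw [mul_add]; exact B.add_mem (ha.2 u hu) (hb.2 u hu)⟩
        smul_mem' := fun c a ha => ⟨A.smul_mem c ha.1, fun u hu => by
          rw [mul_smul_comm]; exact B.smul_mem c (ha.2 u hu)⟩ }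
    have hD : D = B ∨ D = A := by
      refine h.eq_or_eq_of_mul_left
        (fun b hb => ⟨h.lt.le hb, fun u _ => h.ideal_bot.mul_left u b hb⟩) (fun a ha => ha.1) ?_
      rintro s a ⟨ha, hua⟩
      refine ⟨h.ideal_top.mul_left _ _ ha, fun u hu => ?_⟩
      have e : u * (s * a) = s * (u * a) - (s * u) * a := by
        rw [IsLeibniz.leibniz s u a]; abel
      rw [e]
      exact B.sub_mem (h.ideal_bot.mul_left _ _ (hua u hu))
        (hua _ (lowerCentralSeries_square_top_mul_left k s hu))
    rcases hD with e | e
    · refine hBC.not_ge fun c hc => e ▸ (⟨hCA hc, fun u hu => hNC u hu c hc⟩ : c ∈ D)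
    · exact hmin k k.lt_succ_self fun u hu a ha => (e ▸ ha : a ∈ D).2 u hu

/-- If `x * y` acts non-nilpotently on the chief factor `A / B`, then the subalgebra generated by
`x` and `y` is `L` or avoids `A / B`. -/
theorem adjoin_eq_top_or_inf_le (h : IsChiefFactor B A) (hab : ∀ a ∈ A, ∀ b ∈ A, a * b ∈ B)
    (hmin : ∀ S : NonUnitalSubalgebra F L, S ≠ ⊤ → IsStronglySolvable S)
    (hB : ∀ n, ¬ lowerCentralSeries (square (⊤ : NonUnitalSubalgebra F L)) n ≤ B)
    {x y a₀ : L} (ha₀ : a₀ ∈ A) (hn : ∀ j, (LinearMap.mulLeft F (x * y) ^ j) a₀ ∉ B)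
    {S : NonUnitalSubalgebra F L} (hx : x ∈ S.toSubmodule ⊔ A) (hy : y ∈ S.toSubmodule ⊔ A) :
    S = ⊤ ∨ S.toSubmodule ⊓ A ≤ B := by
  have hSA : S.toSubmodule ⊔ A = ⊤ := by
    by_contra hne
    have hne' : addIdeal S A h.ideal_top ≠ ⊤ := fun e => hne <| eq_top_iff.2 fun z _ =>
      mem_addIdeal.1 (e ▸ NonUnitalAlgebra.mem_top : z ∈ addIdeal S A h.ideal_top)
    obtain ⟨n, hnil⟩ := hmin _ hne'
    have hm : x * y ∈ addIdeal S A h.ideal_top := (addIdeal S A h.ideal_top).mul_mem hx hy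
    -- The element a₀ need not lie in (S + A)², but (xy)a₀ does; this costs one extra power.
    have h1 := mulLeft_pow_mem_lowerCentralSeries
      (mul_mem_square (S := addIdeal S A h.ideal_top) hx hy)
      (mul_mem_square hm (Submodule.mem_sup_right ha₀ : a₀ ∈ addIdeal S A h.ideal_top)) n
    rw [hnil, Submodule.mem_bot, ← mulLeft_pow_succ_apply] at h1
    exact hn (n + 1) (h1 ▸ B.zero_mem)
  have hl : ∀ s : L, ∀ c ∈ S.toSubmodule ⊓ A ⊔ B, s * c ∈ S.toSubmodule ⊓ A ⊔ B := by
    intro z c hc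
    obtain ⟨d, ⟨hdS, hdA⟩, b, hb, rfl⟩ := Submodule.mem_sup.1 hc
    obtain ⟨s, hs, a, ha, rfl⟩ := Submodule.mem_sup.1 (hSA ▸ Submodule.mem_top : z ∈ S.toSubmodule ⊔ A)
    refine Submodule.mem_sup.2 ⟨s * d, ⟨S.mul_mem hs hdS, h.ideal_top.mul_left _ _ hdA⟩,
      a * d + (s + a) * b, ?_, ?_⟩
    · exact B.add_mem (hab _ ha _ hdA) (h.ideal_bot.mul_left _ _ hb)
    · rw [mul_add, add_mul s a d]; abel
  rcases h.eq_or_eq_of_mul_left le_sup_right (sup_le inf_le_right h.lt.le) hl with e | e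
  · exact Or.inr (e ▸ le_sup_left)
  · left
    by_contra hne
    -- If S + B = L, nilpotency of S² would make L² nilpotent modulo B.
    have hSB : S.toSubmodule ⊔ B = ⊤ := by
      refine eq_top_iff.2 (hSA ▸ sup_le le_sup_left ?_)
      calc A = S.toSubmodule ⊓ A ⊔ B := e.symm
        _ ≤ _ := sup_le_sup_right inf_le_left _
    obtain ⟨n, hnil⟩ := hmin S hne
    refine hB n ((lowerCentralSeries_square_top_le h.ideal_bot hSB n).trans ?_)
    rw [hnil, bot_sup_eq]

end IsChiefFactor

end Leibniz

theorem mainTheorem7 {F L : Type*} [Field F] [NonUnitalNonAssocRing L] [Module F L]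
    [IsScalarTower F L L] [SMulCommClass F L L] [FiniteDimensional F L] [IsLeibniz L]
    (hsolv : Leibniz.IsSolvable (⊤ : NonUnitalSubalgebra F L))
    (hmin : Leibniz.IsMinimallyNonStronglySolvable F L) :
    Leibniz.IsTwoGenerated F L := by
  open Leibniz in
  obtain ⟨B, A, h, hB, n, hA⟩ := exists_isChiefFactor hmin.1
  have hab : ∀ a ∈ A, ∀ b ∈ A, a * b ∈ B := fun a ha b hb => h.mul_mem_of_isSolvable hsolv ha hb
  obtain ⟨x, y, a₀, ha₀, hn⟩ := h.exists_mul_not_nilpotent hab hA hB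
  obtain ⟨a, ha, b, hb, habB, hne⟩ := h.exists_mul_add_mul_mem x y
  have hxy : x * y ∈ square (⊤ : NonUnitalSubalgebra F L) :=
    mul_mem_square NonUnitalAlgebra.mem_top NonUnitalAlgebra.mem_top
  have hpow : ∀ s : L, (LinearMap.mulLeft F (x * y) ^ (n + 1)) s ∈ A := fun s => by
    rw [mulLeft_pow_succ_apply]
    exact hA (mulLeft_pow_mem_lowerCentralSeries hxy
      (mul_mem_square NonUnitalAlgebra.mem_top NonUnitalAlgebra.mem_top) n)
  by_contra hgen
  have hgen' : ∀ u v : L, NonUnitalAlgebra.adjoin F {u, v} ≠ ⊤ := fun u v e => hgen ⟨u, v, e⟩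
  have key : ∀ c ∈ A, ∀ d ∈ A, x * d + c * y ∈ B →
      ∀ z ∈ NonUnitalAlgebra.adjoin F {x + c, y + d},
        (LinearMap.mulLeft F (x * y) ^ (n + 1)) z ∈ B := by
    intro c hc d hd hcd z hz
    set T := NonUnitalAlgebra.adjoin F {x + c, y + d} with hT
    have hxT : x + c ∈ T := NonUnitalAlgebra.subset_adjoin F (by simp)
    have hyT : y + d ∈ T := NonUnitalAlgebra.subset_adjoin F (by simp)
    have hx : x ∈ T.toSubmodule ⊔ A :=
      Submodule.mem_sup.2 ⟨x + c, hxT, -c, A.neg_mem hc, by abel⟩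
    have hy : y ∈ T.toSubmodule ⊔ A :=
      Submodule.mem_sup.2 ⟨y + d, hyT, -d, A.neg_mem hd, by abel⟩
    have hTA := (h.adjoin_eq_top_or_inf_le hab hmin.2 hB ha₀ hn hx hy).resolve_left (hgen' _ _)
    have hm : (x + c) * (y + d) - x * y ∈ B := by
      have : (x + c) * (y + d) - x * y = (x * d + c * y) + c * d := by
        rw [add_mul, mul_add, mul_add]; abel
      rw [this]
      exact B.add_mem hcd (hab _ hc _ hd)
    have hdiff := mulLeft_pow_sub_mem (F := F) h.ideal_bot hm (n + 1) z
    have hmem : (LinearMap.mulLeft F ((x + c) * (y + d)) ^ (n + 1)) z ∈ B := by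
      -- The true product of the generators preserves T, while its power lands in A because it
      -- agrees with that of xy modulo B.
      refine hTA ⟨mulLeft_pow_mem (C := T.toSubmodule)
        (fun w hw => T.mul_mem (T.mul_mem hxT hyT) hw) _ hz, ?_⟩
      have := A.add_mem (h.lt.le hdiff) (hpow z)
      simpa using this
    simpa using B.sub_mem hmem hdiff
  have key₀ := key 0 A.zero_mem 0 A.zero_mem (by simp)
  have key₁ := key a ha b hb habB
  refine hne ⟨h.mem_of_mulLeft_pow_mem hab hpow ha₀ hn ha (j := n + 1) ?_,
    h.mem_of_mulLeft_pow_mem hab hpow ha₀ hn hb (j := n + 1) ?_⟩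
  · have := B.sub_mem (key₁ (x + a) (NonUnitalAlgebra.subset_adjoin F (by simp)))
      (key₀ x (NonUnitalAlgebra.subset_adjoin F (by simp)))
    simpa using this
  · have := B.sub_mem (key₁ (y + b) (NonUnitalAlgebra.subset_adjoin F (by simp)))
      (key₀ y (NonUnitalAlgebra.subset_adjoin F (by simp)))
    simpa using this
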